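/- Let $\mathfrak g$ be a finite-dimensional real step-two nilpotent Lie algebra with an inner product $\langle\cdot,\cdot\rangle$, with center $\mathfrak z$ and $\mathfrak b=\mathfrak z^{\perp}$, and suppose that $\mathfrak g$ is of $H$-type: for every $Z\in\mathfrak z$ the linear map $J_Z:\mathfrak b\to\mathfrak b$ defined by $\langle J_Z X,Y\rangle=\langle Z,[X,Y]\rangle$ $(X,Y\in\mathfrak b)$ satisfies $J_Z^2=-|Z|^2I$. (Thus the connected, simply connected Lie group of $\mathfrak g$ is an $H$-type group.) Let $B_1,\dots,B_{2n}$ and $Z_1,\dots,Z_m$ be orthonormal bases of $\mathfrak b$ and $\mathfrak z$, and define the real $2n\times 2n$ matrices $U^{(k)}=(U^{(k)}_{j,l})$ by $[B_j,B_l]=\sum_{k=1}^m U^{(k)}_{j,l}Z_k$. Identify $x=(x_1,\dots,x_n,y_1,\dots,y_n)\in\mathbb R^{2n}$ with $z=(x_1+iy_1,\dots,x_n+iy_n)\in\mathbb C^n$, and for $w\in\mathbb C^n$ let $U^{(k)}w\in\mathbb C^n$ denote the result of applying $U^{(k)}$ to $w$ regarded as a vector of $\mathbb R^{2n}$. For $s>0$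 let $\mu_s$ be the normalized surface measure on the sphere $\{w\in\mathbb C^n:|w|=s\}$. For $\lambda\in\mathbb R^m\setminus\{0\}$ and continuous $f:\mathbb C^n\to\mathbb C$, the $\lambda$-twisted spherical mean of $f$ is \[ f\times_\lambda\mu_s(z)=\int_{|w|=s}f(z-w)\,e^{\frac i2\sum_{j=1}^m\lambda_j\,\mathrm{Re}\,(z\cdot\overline{U^{(j)}w})}\,d\mu_s(w),\qquad z\cdot\overline{v}=\sum_{i=1}^n z_i\overline{v_i}. \] Theorem. Let $\lambda\in\mathbb R^m\setminus\{0\}$ and $r\ge 0$, and let $f:\mathbb C^n\to\mathbb C$ be a continuous function such that for each integer $k\ge 0$ the function $|z|^k e^{\frac{|\lambda|}{4}|z|^2}f(z)$ is bounded on $\mathbb C^n$. Then $f$ is supported in $\{z\in\mathbb C^n:|z|\le r\}$ if and only if $f\times_\lambda\mu_s(z)=0$ for all $z\in\mathbb C^n$ and all $s>r+|z|$. -/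

import Mathlib

open MeasureTheory

/-- The orthogonal complement `𝔟` of the center `𝔷` of a real Lie algebra `𝔤`, with respect to
an inner product `ip` on `𝔤`. -/
def centerCompl {𝔤 : Type*} [LieRing 𝔤] [LieAlgebra ℝ 𝔤] (ip : LinearMap.BilinForm ℝ 𝔤) :
    Submodule ℝ 𝔤 :=
  ip.orthogonal (LieAlgebra.center ℝ 𝔤).toSubmodule

/-- A finite-dimensional real Lie algebra `𝔤`, nilpotent of step two, with an inner product `ip`,
is of Heisenberg type if for every `Z` in the center the map `J_Z : 𝔟 → 𝔟` defined by
`⟨J_Z X, Y⟩ = ⟨Z, [X, Y]⟩` satisfies `J_Z ^ 2 = -|Z| ^ 2 I`. (That `J_Z` is skew-adjoint is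
automatic, the bracket being alternating.) An H-type group is the connected and simply connected
Lie group of such a Lie algebra. -/
structure IsHType {𝔤 : Type*} [LieRing 𝔤] [LieAlgebra ℝ 𝔤] (ip : LinearMap.BilinForm ℝ 𝔤) :
    Prop where
  finiteDimensional : FiniteDimensional ℝ 𝔤
  symm : ∀ X Y : 𝔤, ip X Y = ip Y X
  pos : ∀ X : 𝔤, X ≠ 0 → 0 < ip X X
  two_step : ∀ X Y W : 𝔤, ⁅⁅X, Y⁆, W⁆ = 0
  not_abelian : ∃ X Y : 𝔤, ⁅X, Y⁆ ≠ 0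
  sq_J : ∀ Z ∈ LieAlgebra.center ℝ 𝔤, ∃ J : centerCompl ip →ₗ[ℝ] centerCompl ip,
    (∀ X Y : centerCompl ip, ip (J X : 𝔤) (Y : 𝔤) = ip Z ⁅(X : 𝔤), (Y : 𝔤)⁆) ∧
      ∀ X : centerCompl ip, J (J X) = -(ip Z Z) • X

/-- A family of vectors is orthonormal for the inner product `ip`. -/
def IsOrthonormalFor {𝔤 ι : Type*} [AddCommGroup 𝔤] [Module ℝ 𝔤] [DecidableEq ι]
    (ip : LinearMap.BilinForm ℝ 𝔤) (v : ι → 𝔤) : Prop :=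
  ∀ i j, ip (v i) (v j) = if i = j then 1 else 0

/-- The matrices `U^(k)` of the structure constants: `[B_j, B_l] = ∑ k, U^(k)_{j l} Z_k`.
The coefficients are read off with the inner product; see `bracket_eq_sum_structureMatrix`. -/
def structureMatrix {𝔤 ι κ : Type*} [LieRing 𝔤] [LieAlgebra ℝ 𝔤] (ip : LinearMap.BilinForm ℝ 𝔤)
    (B : ι → 𝔤) (Z : κ → 𝔤) (k : κ) : Matrix ι ι ℝ :=
  Matrix.of fun j l => ip ⁅B j, B l⁆ (Z k)

theorem bracket_eq_sum_structureMatrix {𝔤 ι : Type*} [LieRing 𝔤] [LieAlgebra ℝ 𝔤]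
    {ip : LinearMap.BilinForm ℝ 𝔤} (h : IsHType ip) {m : ℕ} (B : ι → 𝔤)
    (Z : Module.Basis (Fin m) ℝ (LieAlgebra.center ℝ 𝔤))
    (hZ : IsOrthonormalFor ip fun k => (Z k : 𝔤)) (j l : ι) :
    ⁅B j, B l⁆ = ∑ k, structureMatrix ip B (fun k => (Z k : 𝔤)) k j l • (Z k : 𝔤) := by
  have hc : ⁅B j, B l⁆ ∈ LieAlgebra.center ℝ 𝔤 := by
    rw [LieModule.mem_maxTrivSubmodule]
    intro W
    rw [← lie_skew, h.two_step, neg_zero]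
  have hs := congrArg (LieAlgebra.center ℝ 𝔤).toSubmodule.subtype
    (Z.sum_repr ⟨⁅B j, B l⁆, hc⟩)
  have hs' : ⁅B j, B l⁆ = ∑ k, Z.repr ⟨⁅B j, B l⁆, hc⟩ k • (Z k : 𝔤) := by
    refine hs.symm.trans ?_
    rw [map_sum]
    rfl
  have key : ∀ k, structureMatrix ip B (fun k => (Z k : 𝔤)) k j l
      = Z.repr ⟨⁅B j, B l⁆, hc⟩ k := by
    intro k
    simp only [structureMatrix, Matrix.of_apply]
    conv_lhs => rw [hs']
    simp only [map_sum, map_smul, LinearMap.sum_apply, LinearMap.smul_apply]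
    simp [hZ _ _]
  simp only [key]
  exact hs'

/-- `(x_1, …, x_n, y_1, …, y_n) ↦ (x_1 + i y_1, …, x_n + i y_n)`. -/
noncomputable def complexify {n : ℕ} (x : EuclideanSpace ℝ (Fin n ⊕ Fin n)) :
    EuclideanSpace ℂ (Fin n) :=
  WithLp.toLp 2 fun j => (x (Sum.inl j) : ℂ) + (x (Sum.inr j) : ℂ) * Complex.I

/-- The inverse of `complexify`: `z ↦ (Re z_1, …, Re z_n, Im z_1, …, Im z_n)`. -/
noncomputable def realify {n : ℕ} (z : EuclideanSpace ℂ (Fin n)) :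
    EuclideanSpace ℝ (Fin n ⊕ Fin n) :=
  WithLp.toLp 2 (Sum.elim (fun j => (z j).re) (fun j => (z j).im))

/-- The complexification `U w` of `U ξ`, where `w ∈ ℂⁿ` is the complexification of `ξ`. -/
noncomputable def complexMulVec {n : ℕ} (U : Matrix (Fin n ⊕ Fin n) (Fin n ⊕ Fin n) ℝ)
    (w : EuclideanSpace ℂ (Fin n)) : EuclideanSpace ℂ (Fin n) :=
  complexify (WithLp.toLp 2 (U.mulVec fun i => realify w i))

/-- The normalized surface measure on the sphere `|w| = s` in `ℂⁿ` (for `n ≥ 1`, `s > 0`): the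
image of the normalized surface measure of the unit sphere of `ℝ²ⁿ` under `ω ↦ s ω`. -/
noncomputable def sphereMeasure (n : ℕ) (s : ℝ) : Measure (EuclideanSpace ℂ (Fin n)) :=
  let σ : Measure (Metric.sphere (0 : EuclideanSpace ℝ (Fin n ⊕ Fin n)) 1) :=
    (volume : Measure (EuclideanSpace ℝ (Fin n ⊕ Fin n))).toSphere
  Measure.map (fun ω : Metric.sphere (0 : EuclideanSpace ℝ (Fin n ⊕ Fin n)) 1 =>
    complexify (s • (ω : EuclideanSpace ℝ (Fin n ⊕ Fin n)))) ((σ Set.univ)⁻¹ • σ)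

/-- The `lam`-twisted spherical mean `f ×_lam μ_s` at `z`, that is the integral over `|w| = s` of
`f (z - w) exp ((i / 2) ∑ j, lam_j Re (z · conj (U^(j) w)))`. -/
noncomputable def twistedSphericalMean {n m : ℕ}
    (U : Fin m → Matrix (Fin n ⊕ Fin n) (Fin n ⊕ Fin n) ℝ) (lam : EuclideanSpace ℝ (Fin m))
    (f : EuclideanSpace ℂ (Fin n) → ℂ) (s : ℝ) (z : EuclideanSpace ℂ (Fin n)) : ℂ :=
  ∫ w, f (z - w) * Complex.exp (Complex.I / 2 *
      ((∑ j, lam j * (∑ i, z i * (starRingEnd ℂ) (complexMulVec (U j) w i)).re : ℝ) : ℂ))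
    ∂(sphereMeasure n s)

/-!
The matrix `∑ lam_k U^(k)` defines a skew map `A` of `E = ℝ²ⁿ` with `A² = -a²`, `a = |lam|`: this is
the H-type condition (`phaseMatrix_mul_self`). The substitution `u = z - w` turns the twisted
spherical mean into the integral of `f(u) exp(-(i/2) ⟨z, A u⟩)` over the sphere `|u - z| = s`. If
`f` lives in the ball of radius `r`, spheres with `s > r + |z|` miss its support, which is the easy
direction.

For the converse, fix `ρ > r` and superpose the spheres: for a polynomial `p` and a test function
`φ` on `(ρ², ∞)` let
`I(p, φ)(z) = ∫ f(u) p(u) φ(|u - z|²) exp(-(i/2) ⟨z, A u⟩) du` (`twistedPairing`).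
By hypothesis `I(1, φ)(z) = 0` for all `φ` and all `|z| < ρ - r`. Differentiate in the complexified
direction `a v + i σ A v`, `σ = ±1`, and let `ζ(u) = a ⟨v, u⟩ - i σ ⟨v, A u⟩`, a holomorphic or
antiholomorphic coordinate. If `I(p, φ)` and `I(p, φ')` vanish near `0`, then so does
`I(p ζ, φ' - (σ a / 4) φ)` (`twistedPairing_mul_twistedCoord`). So for each monomial `p` in these
coordinates there is a product `L` of operators `D ± a / 4` with `I(p, L φ)(0) = 0` for all `φ`
(`exists_shiftedDerivs_twistedPairing_eq_zero`).

Thus the radial part of `f p` solves, as a distribution on `(ρ², ∞)`, an ordinary differential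
equation whose solutions are polynomials times `exp (± a t / 4)`, `t = |u|²`. The growth condition
on `f` excludes all of these but zero (`integral_mul_norm_sq_eq_zero_of_shiftedDerivs`); here the
constant `|lam| / 4` of the theorem is used. Consequently `f(u) ψ(|u|²)` is orthogonal to all
polynomials for every test function `ψ` on `(ρ², ∞)`. It has compact support, so it is zero by the
Stone-Weierstrass theorem, and `f = 0` outside the ball of radius `r`
(`eq_zero_of_twistedPairing_eq_zero`).
-/

open Set Filter Topology ContDiff
open scoped RealInnerProductSpace

/-! ### Test functions on a half-line -/

/-- Real test functions on the half-line `(τ, ∞)`: smooth, with compact support inside it. -/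
structure IsTestFunction (τ : ℝ) (φ : ℝ → ℝ) : Prop where
  contDiff : ContDiff ℝ ∞ φ
  hasCompactSupport : HasCompactSupport φ
  tsupport_subset : tsupport φ ⊆ Ioi τ

/-- The differential operator `D + c` on the line. -/
noncomputable def shiftedDeriv (c : ℝ) (φ : ℝ → ℝ) : ℝ → ℝ := fun t => deriv φ t + c * φ t

/-- The composition of the operators `D + c`, `c` in the list `l`. -/
noncomputable def shiftedDerivs (l : List ℝ) (φ : ℝ → ℝ) : ℝ → ℝ := l.foldr shiftedDeriv φ

@[simp] lemma shiftedDerivs_nil (φ : ℝ → ℝ) : shiftedDerivs [] φ = φ := rfl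

@[simp] lemma shiftedDerivs_cons (c : ℝ) (l : List ℝ) (φ : ℝ → ℝ) :
    shiftedDerivs (c :: l) φ = shiftedDeriv c (shiftedDerivs l φ) := rfl

lemma IsTestFunction.continuous {τ : ℝ} {φ : ℝ → ℝ} (h : IsTestFunction τ φ) : Continuous φ :=
  h.contDiff.continuous

lemma IsTestFunction.eq_zero {τ : ℝ} {φ : ℝ → ℝ} (h : IsTestFunction τ φ) {t : ℝ} (ht : t ≤ τ) :
    φ t = 0 := by
  by_contra hne
  exact absurd (h.tsupport_subset (subset_tsupport _ hne)) (not_lt.mpr ht)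

lemma IsTestFunction.sub_smul {τ : ℝ} {φ ψ : ℝ → ℝ} (hφ : IsTestFunction τ φ)
    (hψ : IsTestFunction τ ψ) (k : ℝ) : IsTestFunction τ (fun t => φ t - k * ψ t) where
  contDiff := hφ.contDiff.sub (contDiff_const.mul hψ.contDiff)
  hasCompactSupport := hφ.hasCompactSupport.sub hψ.hasCompactSupport.mul_left
  tsupport_subset := by
    refine (tsupport_sub _ _).trans (union_subset hφ.tsupport_subset ?_)
    exact (tsupport_mul_subset_right).trans hψ.tsupport_subset

lemma IsTestFunction.deriv {τ : ℝ} {φ : ℝ → ℝ} (h : IsTestFunction τ φ) :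
    IsTestFunction τ (deriv φ) where
  contDiff := (contDiff_infty_iff_deriv.mp h.contDiff).2
  hasCompactSupport := h.hasCompactSupport.deriv
  tsupport_subset := tsupport_deriv_subset.trans h.tsupport_subset

lemma IsTestFunction.shiftedDeriv {τ : ℝ} {φ : ℝ → ℝ} (h : IsTestFunction τ φ) (c : ℝ) :
    IsTestFunction τ (shiftedDeriv c φ) := by
  have e : _root_.shiftedDeriv c φ = fun t => _root_.deriv φ t - (-c) * φ t := by
    funext t; simp [_root_.shiftedDeriv]
  exact e ▸ h.deriv.sub_smul h (-c)

lemma IsTestFunction.shiftedDerivs {τ : ℝ} {φ : ℝ → ℝ} (h : IsTestFunction τ φ) (l : List ℝ) :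
    IsTestFunction τ (shiftedDerivs l φ) := by
  induction l with
  | nil => exact h
  | cons c l ih => exact ih.shiftedDeriv c

/-- Multiplication by an exponential and translation to the right preserve test functions. -/
lemma IsTestFunction.exp_mul_translate {τ : ℝ} {φ : ℝ → ℝ} (h : IsTestFunction τ φ) (c : ℝ) {x : ℝ}
    (hx : 0 ≤ x) : IsTestFunction τ (fun t => Real.exp (-(c * t)) * φ (t - x)) where
  contDiff := by
    have := h.contDiff
    fun_prop
  hasCompactSupport := by
    refine HasCompactSupport.mul_left ?_
    exact h.hasCompactSupport.comp_homeomorph (Homeomorph.subRight x)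
  tsupport_subset := by
    refine tsupport_mul_subset_right.trans ?_
    intro t ht
    have h1 : t - x ∈ tsupport φ :=
      (tsupport_comp_eq_preimage φ (Homeomorph.subRight x)).subset ht
    have h2 := h.tsupport_subset h1
    simp only [mem_Ioi] at h2 ⊢
    linarith

lemma deriv_shiftedDeriv {τ : ℝ} {φ : ℝ → ℝ} (h : IsTestFunction τ φ) (c : ℝ) :
    deriv (shiftedDeriv c φ) = shiftedDeriv c (deriv φ) := by
  have h1 : Differentiable ℝ φ := h.contDiff.differentiable (by simp)
  have h2 : Differentiable ℝ (deriv φ) := h.deriv.contDiff.differentiable (by simp)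
  funext t
  have := ((h2 t).hasDerivAt.add ((h1 t).hasDerivAt.const_mul c)).deriv
  exact this

lemma deriv_shiftedDerivs {τ : ℝ} {φ : ℝ → ℝ} (h : IsTestFunction τ φ) (l : List ℝ) :
    deriv (shiftedDerivs l φ) = shiftedDerivs l (deriv φ) := by
  induction l with
  | nil => rfl
  | cons c l ih =>
    rw [shiftedDerivs_cons, deriv_shiftedDeriv (h.shiftedDerivs l), ih]; rfl

lemma shiftedDerivs_sub_smul {τ : ℝ} {φ ψ : ℝ → ℝ} (hφ : IsTestFunction τ φ)
    (hψ : IsTestFunction τ ψ) (k : ℝ) (l : List ℝ) :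
    shiftedDerivs l (fun t => φ t - k * ψ t) =
      fun t => shiftedDerivs l φ t - k * shiftedDerivs l ψ t := by
  induction l with
  | nil => rfl
  | cons c l ih =>
    have h1 := (hφ.shiftedDerivs l).contDiff.differentiable (by simp)
    have h2 := (hψ.shiftedDerivs l).contDiff.differentiable (by simp)
    simp only [shiftedDerivs_cons, ih]
    funext t
    have := ((h1 t).hasDerivAt.sub ((h2 t).hasDerivAt.const_mul k)).deriv
    simp only [shiftedDeriv]
    erw [this]
    ring

lemma shiftedDerivs_shiftedDeriv {τ : ℝ} {φ : ℝ → ℝ} (h : IsTestFunction τ φ) (l : List ℝ) (c : ℝ) :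
    shiftedDerivs l (shiftedDeriv c φ) = shiftedDeriv c (shiftedDerivs l φ) := by
  have e : ∀ ψ : ℝ → ℝ, shiftedDeriv c ψ = fun t => deriv ψ t - (-c) * ψ t := by
    intro ψ; funext t; simp [shiftedDeriv]
  rw [e, shiftedDerivs_sub_smul h.deriv h, ← deriv_shiftedDerivs h, e]

/-- Conjugating `∏ (D + cᵢ)` by `exp (-c t)` and a translation gives `∏ (D + (cᵢ - c))`. -/
lemma shiftedDerivs_exp_mul_translate {τ : ℝ} {χ : ℝ → ℝ} (h : IsTestFunction τ χ) (c x : ℝ)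
    (l : List ℝ) :
    shiftedDerivs l (fun t => Real.exp (-(c * t)) * χ (t - x)) =
      fun t => Real.exp (-(c * t)) * shiftedDerivs (l.map (· - c)) χ (t - x) := by
  induction l with
  | nil => rfl
  | cons d l ih =>
    have h1 := (h.shiftedDerivs (l.map (· - c))).contDiff.differentiable (by simp)
    simp only [shiftedDerivs_cons, ih, List.map_cons]
    funext t
    have e1 : HasDerivAt (fun t => Real.exp (-(c * t))) (Real.exp (-(c * t)) * (-c)) t := by
      simpa using (((hasDerivAt_id t).const_mul c).neg).exp
    have e2 := (h1 (t - x)).hasDerivAt.comp_sub_const t x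
    have := (e1.mul e2).deriv
    simp only [shiftedDeriv]
    erw [this]
    ring

/-- On test functions, the range of `D + c` is the kernel of `ψ ↦ ∫ exp (c t) ψ t dt`. -/
lemma exists_shiftedDeriv_eq {τ : ℝ} {ψ : ℝ → ℝ} (h : IsTestFunction τ ψ) (c : ℝ)
    (h0 : ∫ t, Real.exp (c * t) * ψ t = 0) :
    ∃ φ, IsTestFunction τ φ ∧ shiftedDeriv c φ = ψ := by
  -- the support of `ψ` lies in a bounded interval `(p, q]` inside `(τ, ∞)`
  obtain ⟨p, q, hτp, hpq⟩ : ∃ p q, τ < p ∧ tsupport ψ ⊆ Ioc p q := by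
    obtain ⟨q, hq⟩ := h.hasCompactSupport.isCompact.bddAbove
    rcases (tsupport ψ).eq_empty_or_nonempty with he | hne
    · exact ⟨τ + 1, q, by linarith, by simp [he]⟩
    · have h1 : τ < sInf (tsupport ψ) :=
        h.tsupport_subset (h.hasCompactSupport.isCompact.sInf_mem hne)
      obtain ⟨p, hp1, hp2⟩ := exists_between h1
      exact ⟨p, q, hp1, fun t ht =>
        ⟨hp2.trans_le (csInf_le h.hasCompactSupport.isCompact.bddBelow ht), hq ht⟩⟩
  have hz : ∀ t, t ∉ Ioc p q → Real.exp (c * t) * ψ t = 0 := fun t ht => by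
    rw [image_eq_zero_of_notMem_tsupport (fun h' => ht (hpq h')), mul_zero]
  have hcont : Continuous fun t => Real.exp (c * t) * ψ t := by
    have := h.continuous
    fun_prop
  set G : ℝ → ℝ := fun t => ∫ s in p..t, Real.exp (c * s) * ψ s with hG
  have hGd : ∀ t, HasDerivAt G (Real.exp (c * t) * ψ t) t := fun t =>
    intervalIntegral.integral_hasDerivAt_right (hcont.intervalIntegrable _ _)
      (hcont.stronglyMeasurableAtFilter _ _) hcont.continuousAt
  have hGs : ContDiff ℝ ∞ G := by
    rw [contDiff_infty_iff_deriv]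
    refine ⟨fun t => (hGd t).differentiableAt, ?_⟩
    rw [show deriv G = _ from funext fun t => (hGd t).deriv]
    have := h.contDiff
    fun_prop
  have hG0 : ∀ t, t ∉ Icc p q → G t = 0 := by
    intro t ht
    rcases lt_or_ge t p with htp | htp
    · refine (intervalIntegral.integral_congr_ae (g := fun _ => (0 : ℝ)) ?_).trans (by simp)
      refine Eventually.of_forall fun s hs => hz s fun hs' => ?_
      rw [uIoc_of_ge htp.le] at hs
      exact absurd hs.2 (not_le.mpr hs'.1)
    · have htq : q < t := by
        by_contra hc; exact ht ⟨htp, not_lt.mp hc⟩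
      rw [hG]
      simp only
      rw [intervalIntegral.integral_of_le htp,
        setIntegral_eq_integral_of_forall_compl_eq_zero, h0]
      intro s hs
      exact hz s fun hs' => hs ⟨hs'.1, hs'.2.trans htq.le⟩
  have hsupp : tsupport (fun t => Real.exp (-(c * t)) * G t) ⊆ Icc p q := by
    refine closure_minimal ?_ isClosed_Icc
    intro t ht
    by_contra hc
    exact ht (by simp [hG0 t hc])
  refine ⟨fun t => Real.exp (-(c * t)) * G t, ⟨by fun_prop, ?_, ?_⟩, ?_⟩
  · exact HasCompactSupport.of_support_subset_isCompact isCompact_Icc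
      ((subset_tsupport _).trans hsupp)
  · exact hsupp.trans fun t ht => hτp.trans_le ht.1
  · funext t
    have e1 : HasDerivAt (fun t => Real.exp (-(c * t))) (Real.exp (-(c * t)) * (-c)) t := by
      simpa using (((hasDerivAt_id t).const_mul c).neg).exp
    have := (e1.mul (hGd t)).deriv
    simp only [shiftedDeriv]
    erw [this]
    have hh : Real.exp (-(c * t)) * Real.exp (c * t) = 1 := by rw [← Real.exp_add]; simp
    linear_combination ψ t * hh

/-- A test function with integral one. -/
lemma exists_isTestFunction_integral_eq_one (τ : ℝ) :
    ∃ χ, IsTestFunction τ χ ∧ ∫ t, χ t = 1 := by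
  let b : ContDiffBump (τ + 2) := ⟨1 / 2, 1, by norm_num, by norm_num⟩
  refine ⟨b.normed volume, ⟨b.contDiff_normed, b.hasCompactSupport_normed, ?_⟩, b.integral_normed⟩
  rw [b.tsupport_normed_eq]
  intro t ht
  rw [Real.closedBall_eq_Icc] at ht
  have h1 := ht.1
  have : b.rOut = 1 := rfl
  simp only [mem_Ioi]
  linarith

/-- A nonnegative test function positive at a prescribed point. -/
lemma exists_isTestFunction_pos {τ t₀ : ℝ} (h : τ < t₀) :
    ∃ χ, IsTestFunction τ χ ∧ (∀ t, 0 ≤ χ t) ∧ 0 < χ t₀ := by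
  let b : ContDiffBump t₀ := ⟨(t₀ - τ) / 4, (t₀ - τ) / 2, by linarith, by linarith⟩
  refine ⟨b, ⟨b.contDiff, b.hasCompactSupport, ?_⟩, fun t => b.nonneg, ?_⟩
  · rw [b.tsupport_eq]
    intro t ht
    rw [Real.closedBall_eq_Icc] at ht
    have h1 := ht.1
    have : b.rOut = (t₀ - τ) / 2 := rfl
    simp only [mem_Ioi]
    linarith
  · exact b.pos_of_mem_ball (Metric.mem_ball_self b.rOut_pos)

/-! ### Radial test functions and the elimination of the factors `D + c` -/

section Radial

lemma IsTestFunction.exists_norm_le {E : Type*} [NormedAddCommGroup E] {τ : ℝ} {φ : ℝ → ℝ}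
    (h : IsTestFunction τ φ) : ∃ R, 0 ≤ R ∧ ∀ y : E, φ (‖y‖ ^ 2) ≠ 0 → ‖y‖ ≤ R := by
  obtain ⟨R, hR⟩ := h.hasCompactSupport.isCompact.bddAbove
  refine ⟨|R| + 1, by positivity, fun y hy => ?_⟩
  have h1 : ‖y‖ ^ 2 ≤ R := hR (subset_tsupport _ hy)
  have h2 : R ≤ |R| := le_abs_self R
  nlinarith [norm_nonneg y, abs_nonneg R]

variable {E : Type*} [NormedAddCommGroup E] [InnerProductSpace ℝ E] [FiniteDimensional ℝ E]

lemma IsTestFunction.hasCompactSupport_norm_sq {τ : ℝ} {φ : ℝ → ℝ} (h : IsTestFunction τ φ)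
    (z : E) : HasCompactSupport fun u : E => ((φ (‖u - z‖ ^ 2) : ℝ) : ℂ) := by
  obtain ⟨R, -, hR⟩ := h.exists_norm_le (E := E)
  refine HasCompactSupport.of_support_subset_isCompact (isCompact_closedBall z R) fun u hu => ?_
  rw [mem_closedBall_iff_norm]
  exact hR _ (by simpa using hu)

variable [MeasurableSpace E] [BorelSpace E]

lemma IsTestFunction.integrable_mul_norm_sq {τ : ℝ} {φ : ℝ → ℝ} (h : IsTestFunction τ φ)
    {g : E → ℂ} (hg : Continuous g) (z : E) :
    Integrable fun u : E => g u * ((φ (‖u - z‖ ^ 2) : ℝ) : ℂ) := by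
  refine Continuous.integrable_of_hasCompactSupport ?_ (h.hasCompactSupport_norm_sq z).mul_left
  have := h.continuous
  fun_prop

/-- The decay of `g` makes the pairing with `exp (-c t) η (t - N)`, `t = |u|²`, negligible as
`N → ∞`: the exponential factor is at most `exp (b t)`, and the support moves off to infinity. -/
lemma tendsto_integral_exp_mul_translate {g : E → ℂ} (hg : Continuous g) {b : ℝ}
    (hint : Integrable fun u => ‖g u‖ * Real.exp (b * ‖u‖ ^ 2)) {c : ℝ} (hc : |c| ≤ b) {τ : ℝ}
    {η : ℝ → ℝ} (hη : IsTestFunction τ η) :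
    Tendsto (fun N : ℕ => ∫ u, g u * ((Real.exp (-(c * ‖u‖ ^ 2)) * η (‖u‖ ^ 2 - N) : ℝ) : ℂ))
      atTop (𝓝 0) := by
  obtain ⟨M, hM⟩ := hη.hasCompactSupport.exists_bound_of_continuous hη.continuous
  have hηc := hη.continuous
  rw [← integral_zero E ℂ (μ := volume)]
  refine tendsto_integral_of_dominated_convergence
    (fun u => ‖g u‖ * Real.exp (b * ‖u‖ ^ 2) * M) (fun N => ?_) (hint.mul_const M) (fun N => ?_) ?_
  · exact Continuous.aestronglyMeasurable (by fun_prop)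
  · refine Eventually.of_forall fun u => ?_
    rw [norm_mul, Complex.norm_real, norm_mul, Real.norm_of_nonneg (Real.exp_pos _).le, mul_assoc]
    have h1 : -(c * ‖u‖ ^ 2) ≤ b * ‖u‖ ^ 2 := by
      nlinarith [neg_abs_le c, sq_nonneg ‖u‖]
    gcongr
    exact hM _
  · refine Eventually.of_forall fun u => ?_
    refine tendsto_const_nhds.congr' ?_
    obtain ⟨N₀, hN₀⟩ := exists_nat_ge (‖u‖ ^ 2 - τ)
    filter_upwards [eventually_ge_atTop N₀] with N hN
    have : (N₀ : ℝ) ≤ N := by exact_mod_cast hN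
    rw [hη.eq_zero (by linarith)]
    simp

/-- If `g exp (b |u|²)` is integrable and the radial distribution `φ ↦ ∫ g φ(|u|²)` solves on
`(τ, ∞)` the equation dual to `∏ (D + cᵢ)` with `|cᵢ| ≤ b`, it is zero there. The solutions are
exponential polynomials with exponents `cᵢ`, and none of them but zero decays so fast. The proof
removes one factor `D + c` at a time: its range on test functions has codimension one, and the
missing direction is spanned by a test function that can be moved off to infinity. -/
theorem integral_mul_norm_sq_eq_zero_of_shiftedDerivs {g : E → ℂ} (hg : Continuous g) {b : ℝ}
    (hint : Integrable fun u => ‖g u‖ * Real.exp (b * ‖u‖ ^ 2)) {τ : ℝ} (l : List ℝ)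
    (hl : ∀ c ∈ l, |c| ≤ b)
    (h0 : ∀ φ, IsTestFunction τ φ → ∫ u, g u * ((shiftedDerivs l φ (‖u‖ ^ 2) : ℝ) : ℂ) = 0)
    {ψ : ℝ → ℝ} (hψ : IsTestFunction τ ψ) : ∫ u, g u * ((ψ (‖u‖ ^ 2) : ℝ) : ℂ) = 0 := by
  induction l generalizing ψ with
  | nil => exact h0 ψ hψ
  | cons c l ih =>
    refine ih (fun d hd => hl d (List.mem_cons_of_mem _ hd)) (fun ψ hψ => ?_) hψ
    obtain ⟨χ, hχ, hχ1⟩ := exists_isTestFunction_integral_eq_one τ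
    set k : ℝ := ∫ t, Real.exp (c * t) * ψ t with hk
    -- `χ` with `∫ χ = 1` gives competitors `exp (-c t) χ (t - N)` with `∫ exp (c t) · = 1`
    have key : ∀ N : ℕ, ∫ u, g u * ((shiftedDerivs l ψ (‖u‖ ^ 2) : ℝ) : ℂ) =
        k * ∫ u, g u * ((Real.exp (-(c * ‖u‖ ^ 2)) *
          shiftedDerivs (l.map (· - c)) χ (‖u‖ ^ 2 - N) : ℝ) : ℂ) := by
      intro N
      have hχN := hχ.exp_mul_translate c (Nat.cast_nonneg (α := ℝ) N)
      obtain ⟨φ, hφ, hφe⟩ := exists_shiftedDeriv_eq (hψ.sub_smul hχN k) c (by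
        have e : ∀ t, Real.exp (c * t) * (ψ t - k * (Real.exp (-(c * t)) * χ (t - N))) =
            Real.exp (c * t) * ψ t - k * χ (t - N) := by
          intro t
          have hh : Real.exp (c * t) * Real.exp (-(c * t)) = 1 := by rw [← Real.exp_add]; simp
          linear_combination (-k * χ (t - N)) * hh
        have i1 : Integrable fun t => Real.exp (c * t) * ψ t :=
          Continuous.integrable_of_hasCompactSupport
            (by have := hψ.continuous; fun_prop) hψ.hasCompactSupport.mul_left
        have i2 : Integrable fun t => k * χ (t - N) :=
          ((hχ.continuous.integrable_of_hasCompactSupport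
            hχ.hasCompactSupport).comp_sub_right _).const_mul k
        simp_rw [e]
        rw [integral_sub i1 i2, integral_const_mul, integral_sub_right_eq_self, hχ1, ← hk]
        ring)
      have h1 := h0 φ hφ
      rw [shiftedDerivs_cons, ← shiftedDerivs_shiftedDeriv hφ, hφe,
        shiftedDerivs_sub_smul hψ hχN, shiftedDerivs_exp_mul_translate hχ] at h1
      have i1 := (hψ.shiftedDerivs l).integrable_mul_norm_sq hg 0
      have i2 := ((hχ.shiftedDerivs (l.map (· - c))).exp_mul_translate c
        (Nat.cast_nonneg (α := ℝ) N)).integrable_mul_norm_sq hg 0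
      simp only [sub_zero] at i1 i2
      have e : ∀ u : E, g u * ((shiftedDerivs l ψ (‖u‖ ^ 2) - k * (Real.exp (-(c * ‖u‖ ^ 2)) *
          shiftedDerivs (l.map (· - c)) χ (‖u‖ ^ 2 - N)) : ℝ) : ℂ) =
          g u * ((shiftedDerivs l ψ (‖u‖ ^ 2) : ℝ) : ℂ) - k * (g u * ((Real.exp (-(c * ‖u‖ ^ 2)) *
            shiftedDerivs (l.map (· - c)) χ (‖u‖ ^ 2 - N) : ℝ) : ℂ)) := by
        intro u; push_cast; ring
      simp_rw [e] at h1
      rwa [integral_sub i1 (i2.const_mul _), integral_const_mul, sub_eq_zero] at h1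
    have lim := (tendsto_integral_exp_mul_translate hg hint (hl c List.mem_cons_self)
      (hχ.shiftedDerivs (l.map (· - c)))).const_mul (k : ℂ)
    rw [mul_zero] at lim
    exact tendsto_nhds_unique (tendsto_const_nhds.congr key) lim

end Radial

/-! ### Differentiating the twisted pairing in the centre of the spheres -/

section Pairing

variable {E : Type*} [NormedAddCommGroup E] [InnerProductSpace ℝ E]

/-- For `A² = -a²`, the complex-linear (`σ = 1`) and antilinear (`σ = -1`) coordinate functions
`u ↦ a ⟨v, u⟩ - i σ ⟨v, A u⟩` of the complex structure `A / a`. -/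
noncomputable def twistedCoord (A : E →L[ℝ] E) (a : ℝ) (v : E) (σ : ℝ) (u : E) : ℂ :=
  a * (⟪v, u⟫ : ℝ) - Complex.I * σ * (⟪v, A u⟫ : ℝ)

lemma continuous_twistedCoord (A : E →L[ℝ] E) (a : ℝ) (v : E) (σ : ℝ) :
    Continuous (twistedCoord A a v σ) := by
  unfold twistedCoord
  fun_prop

variable [FiniteDimensional ℝ E] [MeasurableSpace E] [BorelSpace E]

/-- The superposition, with weights given by the test function `φ` in the squared radius, of the
integrals over spheres with centre `z` of `g` twisted by the phase `exp (-(i / 2) ⟨z, A u⟩)`. -/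
noncomputable def twistedPairing (A : E →L[ℝ] E) (g : E → ℂ) (φ : ℝ → ℝ) (z : E) : ℂ :=
  ∫ u, g u * ((φ (‖u - z‖ ^ 2) : ℝ) : ℂ) * Complex.exp (-(Complex.I / 2) * (⟪z, A u⟫ : ℝ))

lemma IsTestFunction.integrable_twisted {τ : ℝ} {φ : ℝ → ℝ} (h : IsTestFunction τ φ)
    (A : E →L[ℝ] E) {g : E → ℂ} (hg : Continuous g) (z : E) :
    Integrable fun u : E => g u * ((φ (‖u - z‖ ^ 2) : ℝ) : ℂ) *
      Complex.exp (-(Complex.I / 2) * (⟪z, A u⟫ : ℝ)) := by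
  refine Continuous.integrable_of_hasCompactSupport ?_
    (h.hasCompactSupport_norm_sq z).mul_left.mul_right
  have := h.continuous
  fun_prop

/-- Differentiation under the integral sign: where the twisted pairing vanishes on a ball about
`0`, so does its derivative in the direction `v`. -/
lemma integral_deriv_twistedPairing_eq_zero (A : E →L[ℝ] E) {g : E → ℂ} (hg : Continuous g) {τ : ℝ}
    {φ : ℝ → ℝ} (hφ : IsTestFunction τ φ) {ε : ℝ}
    (h0 : ∀ z : E, ‖z‖ < ε → twistedPairing A g φ z = 0) {z : E} (hz : ‖z‖ < ε) (v : E) :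
    ∫ u, (g u * ((deriv φ (‖u - z‖ ^ 2) : ℝ) : ℂ) * (-2 * (⟪u - z, v⟫ : ℝ)) +
      g u * ((φ (‖u - z‖ ^ 2) : ℝ) : ℂ) * (-(Complex.I / 2) * (⟪v, A u⟫ : ℝ))) *
      Complex.exp (-(Complex.I / 2) * (⟪z, A u⟫ : ℝ)) = 0 := by
  let F : ℝ → E → ℂ := fun x u => g u * ((φ (‖u - (z + x • v)‖ ^ 2) : ℝ) : ℂ) *
    Complex.exp (-(Complex.I / 2) * (⟪z + x • v, A u⟫ : ℝ))
  let F' : ℝ → E → ℂ := fun x u =>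
    (g u * ((deriv φ (‖u - (z + x • v)‖ ^ 2) : ℝ) : ℂ) * (-2 * (⟪u - (z + x • v), v⟫ : ℝ)) +
      g u * ((φ (‖u - (z + x • v)‖ ^ 2) : ℝ) : ℂ) * (-(Complex.I / 2) * (⟪v, A u⟫ : ℝ))) *
      Complex.exp (-(Complex.I / 2) * (⟪z + x • v, A u⟫ : ℝ))
  have hφc := hφ.continuous
  have hφc' := hφ.deriv.continuous
  have hF'c : Continuous (Function.uncurry F') := by
    simp only [F', Function.uncurry_def]
    fun_prop
  obtain ⟨R, hR0, hR⟩ := hφ.exists_norm_le (E := E)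
  obtain ⟨R', hR'0, hR'⟩ := hφ.deriv.exists_norm_le (E := E)
  -- all the integrands with `|x| ≤ 1` are supported in one ball
  set S := max R R' + (‖z‖ + ‖v‖) with hS
  have hfar : ∀ x ∈ Icc (-1 : ℝ) 1, ∀ u : E, u ∉ Metric.closedBall 0 S → F' x u = 0 := by
    intro x hx u hu
    rw [mem_closedBall_zero_iff, not_le] at hu
    have h1 : max R R' < ‖u - (z + x • v)‖ := by
      have h2 : ‖z + x • v‖ ≤ ‖z‖ + ‖v‖ := by
        refine (norm_add_le _ _).trans ?_
        rw [norm_smul]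
        have : ‖x‖ ≤ 1 := abs_le.mpr hx
        nlinarith [norm_nonneg v]
      have h3 := norm_sub_norm_le u (z + x • v)
      linarith
    have e1 : φ (‖u - (z + x • v)‖ ^ 2) = 0 := by
      by_contra hne
      exact absurd (hR _ hne) (not_le.mpr ((le_max_left _ _).trans_lt h1))
    have e2 : deriv φ (‖u - (z + x • v)‖ ^ 2) = 0 := by
      by_contra hne
      exact absurd (hR' _ hne) (not_le.mpr ((le_max_right _ _).trans_lt h1))
    simp [F', e1, e2]
  obtain ⟨C, hC⟩ := ((isCompact_Icc (a := (-1 : ℝ)) (b := 1)).prod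
    (isCompact_closedBall (0 : E) S)).exists_bound_of_continuousOn hF'c.continuousOn
  have hmain := (hasDerivAt_integral_of_dominated_loc_of_deriv_le (μ := volume) (F := F) (F' := F')
    (x₀ := (0 : ℝ)) (s := Icc (-1 : ℝ) 1)
    (bound := (Metric.closedBall (0 : E) S).indicator fun _ => C)
    (Icc_mem_nhds (by norm_num) (by norm_num))
    (Eventually.of_forall fun x => (hφ.integrable_twisted A hg _).aestronglyMeasurable)
    (hφ.integrable_twisted A hg _)
    (hF'c.comp (Continuous.prodMk_right 0)).aestronglyMeasurable
    (Eventually.of_forall fun u x hx => by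
      by_cases hu : u ∈ Metric.closedBall (0 : E) S
      · rw [indicator_of_mem hu]; exact hC (x, u) ⟨hx, hu⟩
      · rw [indicator_of_notMem hu, hfar x hx u hu, norm_zero])
    ((integrable_indicator_iff measurableSet_closedBall).mpr
      (integrableOn_const (isCompact_closedBall _ _).measure_lt_top.ne))
    (Eventually.of_forall fun u x hx => by
      have d1 : HasDerivAt (fun x : ℝ => z + x • v) v x := by
        simpa using ((hasDerivAt_id x).smul_const v).const_add z
      have d2 : HasDerivAt (fun x : ℝ => ‖u - (z + x • v)‖ ^ 2) (2 * ⟪u - (z + x • v), -v⟫) x :=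
        (d1.const_sub u).norm_sq
      have d3 : HasDerivAt (fun x : ℝ => φ (‖u - (z + x • v)‖ ^ 2))
          (deriv φ (‖u - (z + x • v)‖ ^ 2) * (2 * ⟪u - (z + x • v), -v⟫)) x :=
        ((hφ.contDiff.differentiable (by simp) _).hasDerivAt).comp x d2
      have d4 : HasDerivAt (fun x : ℝ => ⟪z + x • v, A u⟫) ⟪v, A u⟫ x := by
        simpa using d1.inner ℝ (hasDerivAt_const x (A u))
      have d5 := (d4.ofReal_comp.const_mul (-(Complex.I / 2))).cexp
      have d6 := (d3.ofReal_comp.const_mul (g u)).mul d5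
      refine d6.congr_deriv ?_
      simp only [F', inner_neg_right]
      push_cast
      ring)).2
  have hzero : (fun x : ℝ => ∫ u, F x u) =ᶠ[𝓝 0] fun _ => 0 := by
    have hcont : ContinuousAt (fun x : ℝ => ‖z + x • v‖) 0 := by fun_prop
    have hev : ∀ᶠ x : ℝ in 𝓝 0, ‖z + x • v‖ < ε :=
      hcont.eventually_lt_const (by simpa using hz)
    filter_upwards [hev] with x hx using h0 _ hx
  have := hmain.unique ((hasDerivAt_const (0 : ℝ) (0 : ℂ)).congr_of_eventuallyEq hzero)
  simpa [F'] using this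

/-- Differentiation in the complexified direction `a v + i σ A v`, in which both the
phase and the radial weight produce a multiple of the same coordinate function. The derivative of
the radial weight also produces a factor `⟨z, ·⟩`, constant in `u`, which `h1` removes. -/
lemma twistedPairing_mul_twistedCoord {A : E →L[ℝ] E} {a : ℝ}
    (hskew : ∀ x y, ⟪A x, y⟫ = -⟪x, A y⟫) (hsq : ∀ x, A (A x) = -(a ^ 2) • x)
    {g : E → ℂ} (hg : Continuous g) {τ : ℝ} {φ : ℝ → ℝ} (hφ : IsTestFunction τ φ) {ε : ℝ}
    (h0 : ∀ z : E, ‖z‖ < ε → twistedPairing A g φ z = 0)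
    (h1 : ∀ z : E, ‖z‖ < ε → twistedPairing A g (deriv φ) z = 0)
    (v : E) {σ : ℝ} (hσ : σ = 1 ∨ σ = -1) {z : E} (hz : ‖z‖ < ε) :
    twistedPairing A (fun u => g u * twistedCoord A a v σ u) (shiftedDeriv (-(σ * a / 4)) φ) z
      = 0 := by
  have hσ2 : (σ : ℂ) ^ 2 = 1 := by rcases hσ with rfl | rfl <;> norm_num
  have hd := fun w : E => integral_deriv_twistedPairing_eq_zero A hg hφ h0 hz w
  have hint : ∀ w : E, Integrable fun u : E =>
      (g u * ((deriv φ (‖u - z‖ ^ 2) : ℝ) : ℂ) * (-2 * (⟪u - z, w⟫ : ℝ)) +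
      g u * ((φ (‖u - z‖ ^ 2) : ℝ) : ℂ) * (-(Complex.I / 2) * (⟪w, A u⟫ : ℝ))) *
      Complex.exp (-(Complex.I / 2) * (⟪z, A u⟫ : ℝ)) := by
    intro w
    have i1 := hφ.deriv.integrable_twisted A (g := fun u => g u * (-2 * (⟪u - z, w⟫ : ℝ)))
      (by fun_prop) z
    have i2 := hφ.integrable_twisted A
      (g := fun u => g u * (-(Complex.I / 2) * (⟪w, A u⟫ : ℝ))) (by fun_prop) z
    refine (i1.add i2).congr (Eventually.of_forall fun u => ?_)
    simp only [Pi.add_apply]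
    ring
  have e : ∀ u : E, g u * twistedCoord A a v σ u *
      ((shiftedDeriv (-(σ * a / 4)) φ (‖u - z‖ ^ 2) : ℝ) : ℂ) *
        Complex.exp (-(Complex.I / 2) * (⟪z, A u⟫ : ℝ)) =
      (-(a : ℂ) / 2) * ((g u * ((deriv φ (‖u - z‖ ^ 2) : ℝ) : ℂ) * (-2 * (⟪u - z, v⟫ : ℝ)) +
        g u * ((φ (‖u - z‖ ^ 2) : ℝ) : ℂ) * (-(Complex.I / 2) * (⟪v, A u⟫ : ℝ))) *
        Complex.exp (-(Complex.I / 2) * (⟪z, A u⟫ : ℝ))) +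
      (-(Complex.I * σ) / 2) * ((g u * ((deriv φ (‖u - z‖ ^ 2) : ℝ) : ℂ) *
        (-2 * (⟪u - z, A v⟫ : ℝ)) + g u * ((φ (‖u - z‖ ^ 2) : ℝ) : ℂ) *
          (-(Complex.I / 2) * (⟪A v, A u⟫ : ℝ))) *
        Complex.exp (-(Complex.I / 2) * (⟪z, A u⟫ : ℝ))) +
      ((a : ℂ) * (⟪z, v⟫ : ℝ) + Complex.I * σ * (⟪z, A v⟫ : ℝ)) *
        (g u * ((deriv φ (‖u - z‖ ^ 2) : ℝ) : ℂ) *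
        Complex.exp (-(Complex.I / 2) * (⟪z, A u⟫ : ℝ))) := by
    intro u
    have e1 : ⟪A v, A u⟫ = a ^ 2 * ⟪v, u⟫ := by
      rw [hskew, hsq, inner_smul_right]; ring
    have e2 : ⟪u, A v⟫ = -⟪v, A u⟫ := by rw [real_inner_comm, hskew]
    rw [e1, inner_sub_left, inner_sub_left, e2, real_inner_comm v u]
    simp only [twistedCoord, shiftedDeriv]
    push_cast
    linear_combination
      (Complex.I * a * (⟪v, A u⟫ : ℝ) / 4 * g u * ((φ (‖u - z‖ ^ 2) : ℝ) : ℂ) *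
        Complex.exp (-(Complex.I / 2) * (⟪z, A u⟫ : ℝ))) * hσ2 -
      (σ * a ^ 2 * (⟪v, u⟫ : ℝ) / 4 * g u * ((φ (‖u - z‖ ^ 2) : ℝ) : ℂ) *
        Complex.exp (-(Complex.I / 2) * (⟪z, A u⟫ : ℝ))) * Complex.I_sq
  have h1z := h1 z hz
  unfold twistedPairing at h1z ⊢
  simp_rw [e]
  refine (integral_add (((hint v).const_mul _).add ((hint (A v)).const_mul _))
      ((hφ.deriv.integrable_twisted A hg z).const_mul _)).trans ?_
  rw [integral_add' ((hint v).const_mul _) ((hint (A v)).const_mul _), integral_const_mul,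
    integral_const_mul, integral_const_mul, hd, hd, h1z]
  simp

end Pairing

/-! ### Polynomial moments and the support theorem in real coordinates -/

section Moments

variable {E : Type*} [NormedAddCommGroup E] [InnerProductSpace ℝ E]

/-- The monomials in the holomorphic and antiholomorphic coordinates of the complex structure
`A / a`. -/
def coordMonomials (A : E →L[ℝ] E) (a : ℝ) : Submonoid (E → ℂ) :=
  Submonoid.closure {p | ∃ v σ, (σ = 1 ∨ σ = -1) ∧ p = twistedCoord A a v σ}

lemma continuous_of_mem_coordMonomials {A : E →L[ℝ] E} {a : ℝ} {p : E → ℂ}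
    (hp : p ∈ coordMonomials A a) : Continuous p := by
  induction hp using Submonoid.closure_induction with
  | mem p hp =>
    obtain ⟨v, σ, -, rfl⟩ := hp
    exact continuous_twistedCoord A a v σ
  | one => exact continuous_const
  | mul p q _ _ hp hq => exact hp.mul hq

lemma exists_norm_le_of_mem_coordMonomials {A : E →L[ℝ] E} {a : ℝ} {p : E → ℂ}
    (hp : p ∈ coordMonomials A a) : ∃ (C : ℝ) (k : ℕ), 0 ≤ C ∧ ∀ u, ‖p u‖ ≤ C * (1 + ‖u‖) ^ k := by
  induction hp using Submonoid.closure_induction with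
  | mem p hp =>
    obtain ⟨v, σ, hσ, rfl⟩ := hp
    refine ⟨|a| * ‖v‖ + ‖v‖ * ‖A‖, 1, by positivity, fun u => ?_⟩
    have hσ1 : |σ| = 1 := by rcases hσ with rfl | rfl <;> norm_num
    have h1 : |⟪v, u⟫| ≤ ‖v‖ * ‖u‖ := abs_real_inner_le_norm v u
    have h2 : |⟪v, A u⟫| ≤ ‖v‖ * (‖A‖ * ‖u‖) :=
      (abs_real_inner_le_norm v _).trans (by gcongr; exact A.le_opNorm u)
    have h3 : ‖twistedCoord A a v σ u‖ ≤ |a| * |⟪v, u⟫| + |⟪v, A u⟫| := by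
      refine (norm_sub_le _ _).trans ?_
      simp [hσ1]
    have h4 : |a| * |⟪v, u⟫| ≤ |a| * (‖v‖ * ‖u‖) := by gcongr
    have h5 : 0 ≤ |a| * ‖v‖ + ‖v‖ * ‖A‖ := by positivity
    rw [pow_one]
    linarith
  | one => exact ⟨1, 0, zero_le_one, fun u => by simp⟩
  | mul p q _ _ hp hq =>
    obtain ⟨C, k, hC, h1⟩ := hp
    obtain ⟨D, j, hD, h2⟩ := hq
    refine ⟨C * D, k + j, by positivity, fun u => ?_⟩
    rw [Pi.mul_apply, norm_mul]
    calc ‖p u‖ * ‖q u‖ ≤ (C * (1 + ‖u‖) ^ k) * (D * (1 + ‖u‖) ^ j) :=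
          mul_le_mul (h1 u) (h2 u) (norm_nonneg _) (by positivity)
      _ = _ := by ring

/-- Real coordinate polynomials are combinations of the monomials in `ζ` and its conjugate. -/
lemma ofReal_comp_mem_span_coordMonomials (A : E →L[ℝ] E) {a : ℝ} (ha : a ≠ 0) {q : C(E, ℝ)}
    (hq : q ∈ Algebra.adjoin ℝ (range fun v : E => (⟨fun u => ⟪v, u⟫, by fun_prop⟩ : C(E, ℝ)))) :
    (fun u => (q u : ℂ)) ∈ Submodule.span ℂ (coordMonomials A a : Set (E → ℂ)) := by
  set G : Set (E → ℂ) := {p | ∃ v σ, (σ = 1 ∨ σ = -1) ∧ p = twistedCoord A a v σ} with hG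
  have hspan : Submodule.span ℂ (coordMonomials A a : Set (E → ℂ)) =
      Subalgebra.toSubmodule (Algebra.adjoin ℂ G) := (Algebra.adjoin_eq_span ℂ G).symm
  rw [hspan, Subalgebra.mem_toSubmodule]
  induction hq using Algebra.adjoin_induction with
  | mem q hq =>
    obtain ⟨v, rfl⟩ := hq
    have h1 : twistedCoord A a v 1 ∈ Algebra.adjoin ℂ G :=
      Algebra.subset_adjoin ⟨v, 1, Or.inl rfl, rfl⟩
    have h2 : twistedCoord A a v (-1) ∈ Algebra.adjoin ℂ G :=
      Algebra.subset_adjoin ⟨v, -1, Or.inr rfl, rfl⟩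
    convert Subalgebra.smul_mem _ (add_mem h1 h2) (1 / (2 * a : ℂ)) using 1
    funext u
    have ha' : (a : ℂ) ≠ 0 := by exact_mod_cast ha
    simp only [ContinuousMap.coe_mk, Pi.smul_apply, Pi.add_apply, twistedCoord, smul_eq_mul]
    push_cast
    field_simp
    ring
  | algebraMap c => exact Subalgebra.algebraMap_mem _ (c : ℂ)
  | add p q _ _ hp hq =>
    convert add_mem hp hq using 1
    funext u
    simp
  | mul p q _ _ hp hq =>
    convert mul_mem hp hq using 1
    funext u
    simp

variable [FiniteDimensional ℝ E] [MeasurableSpace E] [BorelSpace E]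

/-- Each further coordinate factor costs one more factor `D ± a / 4` on the test functions. -/
lemma exists_shiftedDerivs_twistedPairing_eq_zero {A : E →L[ℝ] E} {a : ℝ} (ha : 0 < a)
    (hskew : ∀ x y, ⟪A x, y⟫ = -⟪x, A y⟫) (hsq : ∀ x, A (A x) = -(a ^ 2) • x)
    {f : E → ℂ} (hf : Continuous f) {τ ε : ℝ}
    (h0 : ∀ φ, IsTestFunction τ φ → ∀ z : E, ‖z‖ < ε → twistedPairing A f φ z = 0)
    {p : E → ℂ} (hp : p ∈ coordMonomials A a) :
    ∃ l : List ℝ, (∀ c ∈ l, |c| ≤ a / 4) ∧ ∀ φ, IsTestFunction τ φ → ∀ z : E, ‖z‖ < ε →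
      twistedPairing A (fun u => f u * p u) (shiftedDerivs l φ) z = 0 := by
  induction hp using Submonoid.closure_induction_right with
  | one => exact ⟨[], by simp, by simpa using h0⟩
  | mul_right p hp q hq ih =>
    obtain ⟨v, σ, hσ, rfl⟩ := hq
    obtain ⟨l, hl, h⟩ := ih
    refine ⟨-(σ * a / 4) :: l, ?_, fun φ hφ z hz => ?_⟩
    · refine List.forall_mem_cons.mpr ⟨?_, hl⟩
      have hσ1 : |σ| = 1 := by rcases hσ with rfl | rfl <;> norm_num
      rw [abs_neg, abs_div, abs_mul, hσ1, abs_of_pos ha, one_mul]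
      norm_num
    · have hpc := continuous_of_mem_coordMonomials (A := A) (a := a) hp
      have := twistedPairing_mul_twistedCoord hskew hsq (hf.mul hpc) (hφ.shiftedDerivs l)
        (h φ hφ) (fun w hw => by
          rw [deriv_shiftedDerivs hφ]; exact h _ hφ.deriv w hw) v hσ hz
      simpa only [Pi.mul_apply, mul_assoc, shiftedDerivs_cons] using this

lemma integrable_norm_mul_mul_exp {f p : E → ℂ} (hf : Continuous f) (hp : Continuous p) {b : ℝ}
    (hdec : ∀ k : ℕ, ∃ C : ℝ, ∀ u, ‖u‖ ^ k * Real.exp (b * ‖u‖ ^ 2) * ‖f u‖ ≤ C)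
    {C : ℝ} {k : ℕ} (hC : 0 ≤ C) (hpk : ∀ u, ‖p u‖ ≤ C * (1 + ‖u‖) ^ k) :
    Integrable fun u => ‖f u * p u‖ * Real.exp (b * ‖u‖ ^ 2) := by
  set d := Module.finrank ℝ E + 1 with hd
  obtain ⟨C₀, hC₀⟩ := hdec 0
  obtain ⟨C₁, hC₁⟩ := hdec (k + d)
  have hI : Integrable fun u : E => (2 ^ (k + d) * (C₀ + C₁) * C) * (1 + ‖u‖) ^ (-(d : ℝ)) :=
    (integrable_one_add_norm (by rw [hd]; push_cast; linarith)).const_mul _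
  refine hI.mono' (Continuous.aestronglyMeasurable (by fun_prop)) (Eventually.of_forall fun u => ?_)
  have hx := norm_nonneg u
  have h1 : (1 + ‖u‖) ^ (k + d) ≤ 2 ^ (k + d) * (1 + ‖u‖ ^ (k + d)) := by
    rcases le_total ‖u‖ 1 with h | h
    · calc (1 + ‖u‖) ^ (k + d) ≤ 2 ^ (k + d) := by gcongr; linarith
        _ ≤ _ := le_mul_of_one_le_right (by positivity) (by linarith [pow_nonneg hx (k + d)])
    · calc (1 + ‖u‖) ^ (k + d) ≤ (2 * ‖u‖) ^ (k + d) := by gcongr; linarith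
        _ = 2 ^ (k + d) * ‖u‖ ^ (k + d) := mul_pow _ _ _
        _ ≤ _ := by gcongr; linarith
  have h2 : (1 + ‖u‖) ^ (k + d) * (Real.exp (b * ‖u‖ ^ 2) * ‖f u‖) ≤
      2 ^ (k + d) * (C₀ + C₁) := by
    have h3 := hC₀ u
    have h4 := hC₁ u
    rw [pow_zero, one_mul] at h3
    calc _ ≤ (2 ^ (k + d) * (1 + ‖u‖ ^ (k + d))) * (Real.exp (b * ‖u‖ ^ 2) * ‖f u‖) := by gcongr
      _ = 2 ^ (k + d) * (Real.exp (b * ‖u‖ ^ 2) * ‖f u‖ +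
          ‖u‖ ^ (k + d) * Real.exp (b * ‖u‖ ^ 2) * ‖f u‖) := by ring
      _ ≤ _ := by gcongr
  rw [Real.norm_of_nonneg (by positivity), Real.rpow_neg (by positivity), Real.rpow_natCast,
    ← div_eq_mul_inv, le_div_iff₀ (by positivity), norm_mul]
  calc ‖f u‖ * ‖p u‖ * Real.exp (b * ‖u‖ ^ 2) * (1 + ‖u‖) ^ d
      ≤ ‖f u‖ * (C * (1 + ‖u‖) ^ k) * Real.exp (b * ‖u‖ ^ 2) * (1 + ‖u‖) ^ d := by
        gcongr; exact hpk u
    _ = ((1 + ‖u‖) ^ (k + d) * (Real.exp (b * ‖u‖ ^ 2) * ‖f u‖)) * C := by ring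
    _ ≤ _ := by gcongr

/-- A continuous compactly supported function orthogonal to all coordinate polynomials is
orthogonal to all continuous functions, by the Stone-Weierstrass theorem. -/
lemma integral_mul_ofReal_eq_zero_of_adjoin {h : E → ℂ} (hh : Continuous h)
    (hcs : HasCompactSupport h)
    (h0 : ∀ q ∈ Algebra.adjoin ℝ
      (range fun v : E => (⟨fun u => ⟪v, u⟫, by fun_prop⟩ : C(E, ℝ))), ∫ u, h u * (q u : ℂ) = 0)
    (q : C(E, ℝ)) : ∫ u, h u * (q u : ℂ) = 0 := by
  have hsep : (Algebra.adjoin ℝ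
      (range fun v : E => (⟨fun u => ⟪v, u⟫, by fun_prop⟩ : C(E, ℝ)))).SeparatesPoints := by
    intro x y hxy
    refine ⟨_, ⟨_, Algebra.subset_adjoin ⟨x - y, rfl⟩, rfl⟩, fun he => hxy ?_⟩
    have he' : ⟪x - y, x⟫ = ⟪x - y, y⟫ := he
    rw [← sub_eq_zero, ← inner_sub_right, inner_self_eq_zero, sub_eq_zero] at he'
    exact he'
  have hi : ∀ p : C(E, ℝ), Integrable fun u => h u * (p u : ℂ) := fun p =>
    Continuous.integrable_of_hasCompactSupport
      (hh.mul (Complex.continuous_ofReal.comp p.continuous)) hcs.mul_right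
  have hn : Integrable fun u => ‖h u‖ := (hh.integrable_of_hasCompactSupport hcs).norm
  rw [← norm_le_zero_iff]
  refine le_of_forall_pos_le_add fun δ hδ => ?_
  set M := ∫ u, ‖h u‖ with hM
  have hM0 : 0 ≤ M := integral_nonneg fun u => norm_nonneg _
  obtain ⟨p, hp, hpq⟩ :=
    ContinuousMap.exists_mem_subalgebra_near_continuous_of_isCompact_of_separatesPoints hsep q
      hcs.isCompact (ε := δ / (M + 1)) (by positivity)
  calc ‖∫ u, h u * (q u : ℂ)‖ = ‖∫ u, (h u * (q u : ℂ) - h u * (p u : ℂ))‖ := by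
        rw [integral_sub (hi q) (hi p), h0 p hp, sub_zero]
    _ ≤ ∫ u, ‖h u‖ * (δ / (M + 1)) := by
        refine norm_integral_le_of_norm_le (hn.mul_const _) (Eventually.of_forall fun u => ?_)
        rw [← mul_sub, norm_mul, ← Complex.ofReal_sub, Complex.norm_real]
        by_cases hu : u ∈ tsupport h
        · gcongr
          rw [norm_sub_rev]
          exact (hpq u hu).le
        · simp [image_eq_zero_of_notMem_tsupport hu]
    _ = M * (δ / (M + 1)) := integral_mul_const _ _
    _ ≤ 0 + δ := by
        rw [zero_add, mul_div_assoc', div_le_iff₀ (by positivity)]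
        nlinarith

/-- A continuous compactly supported function orthogonal to all real continuous functions is
zero. -/
lemma eq_zero_of_forall_integral_mul_ofReal {h : E → ℂ} (hh : Continuous h)
    (hcs : HasCompactSupport h) (h0 : ∀ q : C(E, ℝ), ∫ u, h u * (q u : ℂ) = 0) : h = 0 := by
  have i : ∀ {g : E → ℝ} (_ : Continuous g), Integrable fun u => h u * (g u : ℂ) := fun hg =>
    Continuous.integrable_of_hasCompactSupport (hh.mul (Complex.continuous_ofReal.comp hg))
      hcs.mul_right
  have hre : Continuous fun u => (h u).re := by fun_prop
  have him : Continuous fun u => (h u).im := by fun_prop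
  have h1 := h0 ⟨_, hre⟩
  have h2 := h0 ⟨_, him⟩
  simp only [ContinuousMap.coe_mk] at h1 h2
  have h3 : ∫ u, ((‖h u‖ ^ 2 : ℝ) : ℂ) = 0 := by
    have e : ∀ u, ((‖h u‖ ^ 2 : ℝ) : ℂ) =
        h u * ((h u).re : ℂ) - Complex.I * (h u * ((h u).im : ℂ)) := by
      intro u
      rw [Complex.sq_norm, Complex.normSq_apply]
      refine Complex.ext ?_ ?_
      · simp
      · simp; ring
    simp_rw [e]
    rw [integral_sub (i hre) ((i him).const_mul _), integral_const_mul, h1, h2]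
    simp
  replace h3 := Complex.ofReal_eq_zero.mp ((integral_ofReal (𝕜 := ℂ)).symm.trans h3)
  have hc : Continuous fun u => ‖h u‖ ^ 2 := by fun_prop
  have hcs' : HasCompactSupport fun u => ‖h u‖ ^ 2 :=
    hcs.comp_left (g := fun w : ℂ => ‖w‖ ^ 2) (by simp)
  have h4 := (hc.integral_pos_of_hasCompactSupport_nonneg_nonzero hcs' (fun u => by positivity)
    (μ := volume) (x := ·))
  funext u
  by_contra hne
  exact (h4 u (by simpa using hne)).ne' h3

/-- The support theorem in real coordinates, in terms of smooth superpositions of the spherical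
means over the spheres that enclose the ball of radius `r`. -/
theorem eq_zero_of_twistedPairing_eq_zero {A : E →L[ℝ] E} {a : ℝ} (ha : 0 < a)
    (hskew : ∀ x y, ⟪A x, y⟫ = -⟪x, A y⟫) (hsq : ∀ x, A (A x) = -(a ^ 2) • x)
    {f : E → ℂ} (hf : Continuous f)
    (hdec : ∀ k : ℕ, ∃ C : ℝ, ∀ u, ‖u‖ ^ k * Real.exp (a / 4 * ‖u‖ ^ 2) * ‖f u‖ ≤ C)
    {r : ℝ} (hr : 0 ≤ r)
    (h0 : ∀ ρ, r < ρ → ∀ φ, IsTestFunction (ρ ^ 2) φ → ∀ z : E, ‖z‖ < ρ - r →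
      twistedPairing A f φ z = 0) {u : E} (hu : r < ‖u‖) : f u = 0 := by
  obtain ⟨ρ, hrρ, hρu⟩ := exists_between hu
  obtain ⟨ψ, hψ, -, hψu⟩ := exists_isTestFunction_pos
    (show ρ ^ 2 < ‖u‖ ^ 2 by gcongr; linarith)
  have hψc := hψ.continuous
  have hmono : ∀ p ∈ coordMonomials A a, ∫ u, f u * p u * ((ψ (‖u‖ ^ 2) : ℝ) : ℂ) = 0 := by
    intro p hp
    have hpc := continuous_of_mem_coordMonomials hp
    obtain ⟨C, k, hC, hpk⟩ := exists_norm_le_of_mem_coordMonomials hp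
    obtain ⟨l, hl, h⟩ := exists_shiftedDerivs_twistedPairing_eq_zero ha hskew hsq hf
      (h0 ρ hrρ) hp
    refine integral_mul_norm_sq_eq_zero_of_shiftedDerivs (hf.mul hpc)
      (integrable_norm_mul_mul_exp hf hpc hdec hC hpk) l hl (fun φ hφ => ?_) hψ
    simpa [twistedPairing] using h φ hφ 0 (by simpa using hrρ)
  have hspan : ∀ p ∈ Submodule.span ℂ (coordMonomials A a : Set (E → ℂ)),
      Continuous p ∧ ∫ u, f u * p u * ((ψ (‖u‖ ^ 2) : ℝ) : ℂ) = 0 := by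
    intro p hp
    induction hp using Submodule.span_induction with
    | mem p hp => exact ⟨continuous_of_mem_coordMonomials hp, hmono p hp⟩
    | zero => exact ⟨continuous_const, by simp⟩
    | add p q _ _ hp hq =>
      refine ⟨hp.1.add hq.1, ?_⟩
      have i1 := hψ.integrable_mul_norm_sq (hf.mul hp.1) 0
      have i2 := hψ.integrable_mul_norm_sq (hf.mul hq.1) 0
      simp only [sub_zero, Pi.mul_apply] at i1 i2
      simp_rw [Pi.add_apply, mul_add, add_mul]
      rw [integral_add i1 i2, hp.2, hq.2, add_zero]
    | smul c p _ hp =>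
      refine ⟨hp.1.const_smul c, ?_⟩
      have e : ∀ u, f u * (c • p) u * ((ψ (‖u‖ ^ 2) : ℝ) : ℂ) =
          c * (f u * p u * ((ψ (‖u‖ ^ 2) : ℝ) : ℂ)) := by
        intro u; simp only [Pi.smul_apply, smul_eq_mul]; ring
      simp_rw [e]
      rw [integral_const_mul, hp.2, mul_zero]
  have hcs : HasCompactSupport fun u => f u * ((ψ (‖u‖ ^ 2) : ℝ) : ℂ) := by
    have := hψ.hasCompactSupport_norm_sq (0 : E)
    simp only [sub_zero] at this
    exact this.mul_left
  have hzero := eq_zero_of_forall_integral_mul_ofReal (by fun_prop) hcs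
    (integral_mul_ofReal_eq_zero_of_adjoin (by fun_prop) hcs fun q hq => by
      have := (hspan _ (ofReal_comp_mem_span_coordMonomials A ha.ne' hq)).2
      simpa only [mul_right_comm] using this)
  have := congrFun hzero u
  simp only [Pi.zero_apply, mul_eq_zero, Complex.ofReal_eq_zero] at this
  exact this.resolve_right hψu.ne'

end Moments

/-! ### The complex structure of an H-type algebra -/

section HType

variable {𝔤 : Type*} [LieRing 𝔤] [LieAlgebra ℝ 𝔤] {ip : LinearMap.BilinForm ℝ 𝔤} {n m : ℕ}

/-- The matrix `∑ lam_k U^(k)` of the phase of the twisted spherical means; it is the matrix of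
`X ↦ ⟨Z, [X, ·]⟩` for `Z = ∑ lam_k Z_k`. -/
noncomputable def phaseMatrix (U : Fin m → Matrix (Fin n ⊕ Fin n) (Fin n ⊕ Fin n) ℝ)
    (lam : EuclideanSpace ℝ (Fin m)) : Matrix (Fin n ⊕ Fin n) (Fin n ⊕ Fin n) ℝ :=
  ∑ k, lam k • U k

lemma phaseMatrix_structureMatrix_apply (B : Fin n ⊕ Fin n → 𝔤) (Z : Fin m → 𝔤)
    (lam : EuclideanSpace ℝ (Fin m)) (j l : Fin n ⊕ Fin n) :
    phaseMatrix (structureMatrix ip B Z) lam j l = ip ⁅B j, B l⁆ (∑ k, lam k • Z k) := by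
  simp [phaseMatrix, structureMatrix, Matrix.sum_apply]

lemma phaseMatrix_transpose (B : Fin n ⊕ Fin n → 𝔤) (Z : Fin m → 𝔤)
    (lam : EuclideanSpace ℝ (Fin m)) :
    (phaseMatrix (structureMatrix ip B Z) lam).transpose =
      -phaseMatrix (structureMatrix ip B Z) lam := by
  ext j l
  rw [Matrix.transpose_apply, Matrix.neg_apply, phaseMatrix_structureMatrix_apply,
    phaseMatrix_structureMatrix_apply, ← lie_skew, map_neg, LinearMap.neg_apply]

/-- The H-type condition for `Z = ∑ lam_k Z_k`: the phase matrix represents `J_Z`. -/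
lemma phaseMatrix_mul_self (hH : IsHType ip)
    (B : Module.Basis (Fin n ⊕ Fin n) ℝ (centerCompl ip))
    (hB : IsOrthonormalFor ip fun i => (B i : 𝔤))
    (Z : Module.Basis (Fin m) ℝ (LieAlgebra.center ℝ 𝔤))
    (hZ : IsOrthonormalFor ip fun k => (Z k : 𝔤)) (lam : EuclideanSpace ℝ (Fin m)) :
    phaseMatrix (structureMatrix ip (fun i => (B i : 𝔤)) (fun k => (Z k : 𝔤))) lam *
      phaseMatrix (structureMatrix ip (fun i => (B i : 𝔤)) (fun k => (Z k : 𝔤))) lam =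
        -(‖lam‖ ^ 2) • (1 : Matrix (Fin n ⊕ Fin n) (Fin n ⊕ Fin n) ℝ) := by
  set M := phaseMatrix (structureMatrix ip (fun i => (B i : 𝔤)) (fun k => (Z k : 𝔤))) lam with hM
  set W : 𝔤 := ∑ k, lam k • (Z k : 𝔤) with hW
  have hWc : W ∈ LieAlgebra.center ℝ 𝔤 :=
    sum_mem fun k _ => Submodule.smul_mem (LieAlgebra.center ℝ 𝔤).toSubmodule _ (Z k).2
  have hWW : ip W W = ‖lam‖ ^ 2 := by
    rw [EuclideanSpace.real_norm_sq_eq, hW]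
    simp only [map_sum, map_smul, LinearMap.sum_apply, LinearMap.smul_apply]
    refine Finset.sum_congr rfl fun k _ => ?_
    simp [hZ _ _, sq]
  obtain ⟨J, hJ, hJJ⟩ := hH.sq_J W hWc
  have hrepr : ∀ (X : centerCompl ip) (l), B.repr X l = ip (X : 𝔤) (B l : 𝔤) := by
    intro X l
    conv_rhs => rw [← B.sum_repr X]
    simp only [Submodule.coe_sum, Submodule.coe_smul, map_sum, map_smul, LinearMap.sum_apply,
      LinearMap.smul_apply]
    simp [hB _ _]
  have hJB : ∀ j, J (B j) = ∑ l, M j l • B l := by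
    intro j
    conv_lhs => rw [← B.sum_repr (J (B j))]
    refine Finset.sum_congr rfl fun l _ => ?_
    rw [hrepr, hJ, hH.symm, hM, phaseMatrix_structureMatrix_apply]
  ext j i
  have h1 := congrArg (fun X => B.repr X i) (hJJ (B j))
  simp only [hWW, hJB, map_sum, map_smul, Finsupp.coe_finsetSum, Finset.sum_apply,
    Finsupp.coe_smul, Pi.smul_apply, Module.Basis.repr_self, smul_eq_mul] at h1
  simp only [Finsupp.single_apply, mul_ite, mul_one, mul_zero, Finset.sum_ite_eq',
    Finset.mem_univ, if_true] at h1
  rw [Matrix.mul_apply, h1]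
  simp [Matrix.one_apply]

end HType

/-! ### Twisted spherical means in real coordinates -/

section RealCoordinates

variable {n m : ℕ}

lemma realify_complexify (x : EuclideanSpace ℝ (Fin n ⊕ Fin n)) : realify (complexify x) = x := by
  ext i
  rcases i with i | i <;> simp [realify, complexify]

lemma complexify_realify (z : EuclideanSpace ℂ (Fin n)) : complexify (realify z) = z := by
  ext i
  simp [realify, complexify]

lemma complexify_sub (x y : EuclideanSpace ℝ (Fin n ⊕ Fin n)) :
    complexify (x - y) = complexify x - complexify y := by
  ext i
  simp only [complexify, PiLp.sub_apply]
  push_cast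
  ring

lemma norm_complexify (x : EuclideanSpace ℝ (Fin n ⊕ Fin n)) : ‖complexify x‖ = ‖x‖ := by
  rw [EuclideanSpace.norm_eq, EuclideanSpace.norm_eq, Fintype.sum_sum_type, ← Finset.sum_add_distrib]
  congr 1
  refine Finset.sum_congr rfl fun i _ => ?_
  rw [Complex.sq_norm, Complex.normSq_apply]
  simp [complexify, sq]

lemma continuous_complexify : Continuous (complexify (n := n)) := by
  unfold complexify
  fun_prop

lemma continuous_realify : Continuous (realify (n := n)) := by
  unfold realify
  refine (PiLp.continuous_toLp 2 _).comp (continuous_pi fun i => ?_)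
  rcases i with i | i <;> simp <;> fun_prop

lemma continuous_complexMulVec (U : Matrix (Fin n ⊕ Fin n) (Fin n ⊕ Fin n) ℝ) :
    Continuous (complexMulVec U) := by
  unfold complexMulVec
  refine continuous_complexify.comp ((PiLp.continuous_toLp 2 _).comp ?_)
  exact Continuous.matrix_mulVec continuous_const (continuous_pi fun i =>
    (PiLp.continuous_apply 2 _ i).comp continuous_realify)

lemma re_sum_complexify_mul_conj (x y : EuclideanSpace ℝ (Fin n ⊕ Fin n)) :
    (∑ i, complexify x i * (starRingEnd ℂ) (complexify y i)).re = ⟪x, y⟫ := by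
  rw [PiLp.inner_apply, Fintype.sum_sum_type, ← Finset.sum_add_distrib, Complex.re_sum]
  refine Finset.sum_congr rfl fun i _ => ?_
  simp [complexify]
  ring

/-- The phase of the twisted spherical mean is `⟨x, A w⟩`, where `A` has the phase matrix. -/
lemma sum_mul_re_eq_inner (U : Fin m → Matrix (Fin n ⊕ Fin n) (Fin n ⊕ Fin n) ℝ)
    (lam : EuclideanSpace ℝ (Fin m)) (x w : EuclideanSpace ℝ (Fin n ⊕ Fin n)) :
    ∑ j, lam j * (∑ i, complexify x i *
      (starRingEnd ℂ) (complexMulVec (U j) (complexify w) i)).re =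
      ⟪x, Matrix.toEuclideanCLM (𝕜 := ℝ) (phaseMatrix U lam) w⟫ := by
  have h1 : ∀ j, complexMulVec (U j) (complexify w) =
      complexify (Matrix.toEuclideanCLM (𝕜 := ℝ) (U j) w) := by
    intro j
    unfold complexMulVec
    rw [realify_complexify]
    rfl
  simp_rw [h1, re_sum_complexify_mul_conj, phaseMatrix, map_sum, map_smul]
  simp [inner_sum, inner_smul_right]

/-- Up to a constant that is nonzero unless the unit sphere is null, the twisted spherical mean is
an integral over the unit sphere of `ℝ²ⁿ`. -/
lemma twistedSphericalMean_eq_zero_iff (U : Fin m → Matrix (Fin n ⊕ Fin n) (Fin n ⊕ Fin n) ℝ)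
    (lam : EuclideanSpace ℝ (Fin m)) {f : EuclideanSpace ℂ (Fin n) → ℂ} (hf : Continuous f)
    (s : ℝ) (x : EuclideanSpace ℝ (Fin n ⊕ Fin n)) :
    twistedSphericalMean U lam f s (complexify x) = 0 ↔
      ∫ ξ : Metric.sphere (0 : EuclideanSpace ℝ (Fin n ⊕ Fin n)) 1,
        f (complexify (x - s • (ξ : EuclideanSpace ℝ (Fin n ⊕ Fin n)))) *
          Complex.exp (Complex.I / 2 * (⟪x, Matrix.toEuclideanCLM (𝕜 := ℝ) (phaseMatrix U lam)
            (s • (ξ : EuclideanSpace ℝ (Fin n ⊕ Fin n)))⟫ : ℝ))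
        ∂(volume : Measure (EuclideanSpace ℝ (Fin n ⊕ Fin n))).toSphere = 0 := by
  have hphase : Continuous fun w => ∑ j, lam j * (∑ i, complexify x i *
      (starRingEnd ℂ) (complexMulVec (U j) w i)).re := by
    refine continuous_finsetSum _ fun j _ => continuous_const.mul (Complex.continuous_re.comp ?_)
    refine continuous_finsetSum _ fun i _ => continuous_const.mul (Complex.continuous_conj.comp ?_)
    exact (PiLp.continuous_apply 2 _ i).comp (continuous_complexMulVec (U j))
  have hmap : Continuous fun ξ : Metric.sphere (0 : EuclideanSpace ℝ (Fin n ⊕ Fin n)) 1 =>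
      complexify (s • (ξ : EuclideanSpace ℝ (Fin n ⊕ Fin n))) :=
    continuous_complexify.comp (by fun_prop)
  unfold twistedSphericalMean sphereMeasure
  rw [integral_map hmap.aemeasurable (Continuous.aestronglyMeasurable ?_),
    integral_smul_measure]
  simp_rw [sum_mul_re_eq_inner, ← complexify_sub]
  rw [smul_eq_zero, ENNReal.toReal_eq_zero_iff, ENNReal.inv_eq_zero, ENNReal.inv_eq_top,
    Measure.measure_univ_eq_zero]
  · constructor
    · rintro ((h | h) | h)
      · exact absurd h (measure_ne_top _ _)
      · simp [h]
      · exact h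
    · exact Or.inr
  · exact (hf.comp (by fun_prop)).mul (Complex.continuous_exp.comp
      (continuous_const.mul (Complex.continuous_ofReal.comp hphase)))

/-- Integration in polar coordinates. -/
lemma integral_eq_zero_of_forall_sphere {E : Type*} [NormedAddCommGroup E] [NormedSpace ℝ E]
    [FiniteDimensional ℝ E] [Nontrivial E] [MeasurableSpace E] [BorelSpace E] (μ : Measure E)
    [μ.IsAddHaarMeasure] {G : E → ℂ} (hG : Integrable G μ)
    (h0 : ∀ s : ℝ, 0 < s → ∫ ξ : Metric.sphere (0 : E) 1, G (s • (ξ : E)) ∂μ.toSphere = 0) :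
    ∫ x, G x ∂μ = 0 := by
  have hmp := μ.measurePreserving_homeomorphUnitSphereProd
  have hme := (homeomorphUnitSphereProd E).measurableEmbedding
  have e : ∀ y : ({0}ᶜ : Set E), G y =
      (fun p : Metric.sphere (0 : E) 1 × Ioi (0 : ℝ) => G (p.2.1 • p.1.1))
        (homeomorphUnitSphereProd E y) := by
    intro y
    have := congrArg Subtype.val ((homeomorphUnitSphereProd E).symm_apply_apply y)
    rw [homeomorphUnitSphereProd_symm_apply_coe] at this
    simp only [this]
  have h1 : ∫ x, G x ∂μ = ∫ y : ({0}ᶜ : Set E), G y ∂(μ.comap (↑)) := by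
    rw [integral_subtype_comap (measurableSet_singleton _).compl,
      restrict_compl_singleton]
  have hint : Integrable (fun p : Metric.sphere (0 : E) 1 × Ioi (0 : ℝ) => G (p.2.1 • p.1.1))
      (μ.toSphere.prod (Measure.volumeIoiPow (Module.finrank ℝ E - 1))) := by
    rw [← hmp.integrable_comp_emb hme]
    have : Integrable (fun y : ({0}ᶜ : Set E) => G y) (μ.comap (↑)) :=
      (integrableOn_iff_comap_subtypeVal (measurableSet_singleton (0 : E)).compl).mp
        hG.integrableOn
    exact this.congr (Eventually.of_forall e)
  have h2 := hmp.integral_comp hme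
    (fun p : Metric.sphere (0 : E) 1 × Ioi (0 : ℝ) => G (p.2.1 • p.1.1))
  rw [h1, integral_congr_ae (Eventually.of_forall e)]
  refine h2.trans ?_
  rw [integral_prod_symm _ hint]
  exact integral_eq_zero_of_ae (Eventually.of_forall fun s => h0 s.1 s.2)

/-- Vanishing twisted spherical means about `x` give a vanishing twisted pairing at `x`, by
polar coordinates about `x`. -/
lemma twistedPairing_eq_zero_of_sphere {E : Type*} [NormedAddCommGroup E] [InnerProductSpace ℝ E]
    [FiniteDimensional ℝ E] [Nontrivial E] [MeasurableSpace E] [BorelSpace E] {A : E →L[ℝ] E}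
    (hskew : ∀ x y, ⟪A x, y⟫ = -⟪x, A y⟫) {g : E → ℂ} (hg : Continuous g) {ρ : ℝ}
    {φ : ℝ → ℝ} (hφ : IsTestFunction (ρ ^ 2) φ) {x : E}
    (h0 : ∀ s, ρ < s → ∫ ξ : Metric.sphere (0 : E) 1, g (x - s • (ξ : E)) *
      Complex.exp (Complex.I / 2 * (⟪x, A (s • (ξ : E))⟫ : ℝ))
        ∂(volume : Measure E).toSphere = 0) :
    twistedPairing A g φ x = 0 := by
  have hφc := hφ.continuous
  have hxx : ⟪x, A x⟫ = 0 := by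
    have := hskew x x
    rw [real_inner_comm] at this
    linarith
  have e : ∀ w : E, g (x - w) * ((φ (‖(x - w) - x‖ ^ 2) : ℝ) : ℂ) *
      Complex.exp (-(Complex.I / 2) * (⟪x, A (x - w)⟫ : ℝ)) =
      ((φ (‖w‖ ^ 2) : ℝ) : ℂ) * (g (x - w) * Complex.exp (Complex.I / 2 * (⟪x, A w⟫ : ℝ))) := by
    intro w
    rw [sub_sub_cancel_left, norm_neg, map_sub, inner_sub_right, hxx, zero_sub]
    push_cast
    ring_nf
  have hint := (hφ.integrable_twisted A hg x).comp_sub_left x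
  unfold twistedPairing
  rw [← integral_sub_left_eq_self _ volume x]
  simp_rw [e] at hint ⊢
  refine integral_eq_zero_of_forall_sphere volume hint fun s hs => ?_
  have hn : ∀ ξ : Metric.sphere (0 : E) 1, ‖s • (ξ : E)‖ = s := fun ξ => by
    rw [norm_smul, norm_eq_of_mem_sphere, mul_one, Real.norm_of_nonneg hs.le]
  simp_rw [hn]
  rw [integral_const_mul]
  rcases le_or_gt s ρ with h | h
  · rw [hφ.eq_zero (by gcongr), Complex.ofReal_zero, zero_mul]
  · rw [h0 s h, mul_zero]

end RealCoordinates

/-! ### The support theorem on H-type groups -/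

theorem mainTheorem5 {𝔤 : Type*} [LieRing 𝔤] [LieAlgebra ℝ 𝔤]
    (ip : LinearMap.BilinForm ℝ 𝔤) (hH : IsHType ip) {n m : ℕ}
    (B : Module.Basis (Fin n ⊕ Fin n) ℝ (centerCompl ip))
    (hB : IsOrthonormalFor ip fun i => (B i : 𝔤))
    (Z : Module.Basis (Fin m) ℝ (LieAlgebra.center ℝ 𝔤))
    (hZ : IsOrthonormalFor ip fun k => (Z k : 𝔤))
    (lam : EuclideanSpace ℝ (Fin m)) (hlam : lam ≠ 0)
    (r : ℝ) (hr : 0 ≤ r)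
    (f : EuclideanSpace ℂ (Fin n) → ℂ) (hf : Continuous f)
    (hbdd : ∀ k : ℕ, ∃ C : ℝ, ∀ z : EuclideanSpace ℂ (Fin n),
      ‖((‖z‖ ^ k * Real.exp (‖lam‖ / 4 * ‖z‖ ^ 2) : ℝ) : ℂ) * f z‖ ≤ C) :
    tsupport f ⊆ Metric.closedBall 0 r ↔
      ∀ (z : EuclideanSpace ℂ (Fin n)) (s : ℝ), r + ‖z‖ < s →
        twistedSphericalMean
          (structureMatrix ip (fun i => (B i : 𝔤)) (fun k => (Z k : 𝔤))) lam f s z = 0 := by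
  constructor
  · intro hsupp z s hs
    rw [← complexify_realify z] at hs ⊢
    set x := realify z
    rw [norm_complexify] at hs
    rw [twistedSphericalMean_eq_zero_iff _ _ hf]
    refine integral_eq_zero_of_ae (Eventually.of_forall fun ξ => ?_)
    have h1 : complexify (x - s • (ξ : EuclideanSpace ℝ (Fin n ⊕ Fin n))) ∉ tsupport f := by
      intro h
      have h2 := mem_closedBall_zero_iff.mp (hsupp h)
      rw [norm_complexify, norm_sub_rev] at h2
      have h3 := norm_sub_norm_le (s • (ξ : EuclideanSpace ℝ (Fin n ⊕ Fin n))) x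
      have h4 : 0 ≤ s := by linarith [norm_nonneg x]
      rw [norm_smul, norm_eq_of_mem_sphere, mul_one, Real.norm_of_nonneg h4] at h3
      linarith
    simp [image_eq_zero_of_notMem_tsupport h1]
  · intro hmean
    refine closure_minimal (fun z hz => ?_) Metric.isClosed_closedBall
    rw [mem_closedBall_zero_iff]
    by_contra! hzr
    refine hz ?_
    rw [← complexify_realify z]
    rw [← complexify_realify z, norm_complexify] at hzr
    rcases subsingleton_or_nontrivial (EuclideanSpace ℝ (Fin n ⊕ Fin n)) with hE | hE
    · rw [Subsingleton.elim (realify z) 0, norm_zero] at hzr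
      exact absurd hzr (not_lt.mpr hr)
    set M := phaseMatrix (structureMatrix ip (fun i => (B i : 𝔤)) (fun k => (Z k : 𝔤))) lam with hM
    have hskew : ∀ x y, ⟪Matrix.toEuclideanCLM (𝕜 := ℝ) M x, y⟫ =
        -⟪x, Matrix.toEuclideanCLM (𝕜 := ℝ) M y⟫ := by
      intro x y
      rw [← ContinuousLinearMap.adjoint_inner_right, ← ContinuousLinearMap.star_eq_adjoint,
        ← map_star, Matrix.star_eq_conjTranspose, Matrix.conjTranspose_eq_transpose_of_trivial, hM,
        phaseMatrix_transpose, map_neg, neg_apply, inner_neg_right]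
    have hsq : ∀ x, Matrix.toEuclideanCLM (𝕜 := ℝ) M (Matrix.toEuclideanCLM (𝕜 := ℝ) M x) =
        -(‖lam‖ ^ 2) • x := by
      intro x
      rw [← mul_apply_eq_comp, ← map_mul, hM, phaseMatrix_mul_self hH B hB Z hZ,
        map_smul, map_one]
      rfl
    refine eq_zero_of_twistedPairing_eq_zero (f := fun x => f (complexify x))
      (norm_pos_iff.mpr hlam) hskew hsq (hf.comp continuous_complexify) (fun k => ?_) hr
      (fun ρ hρ φ hφ x hx => ?_) hzr
    · obtain ⟨C, hC⟩ := hbdd k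
      refine ⟨C, fun u => ?_⟩
      have := hC (complexify u)
      rwa [norm_mul, Complex.norm_real, norm_complexify, Real.norm_of_nonneg (by positivity)] at this
    · refine twistedPairing_eq_zero_of_sphere hskew (hf.comp continuous_complexify) hφ
        fun s hs => ?_
      rw [Function.comp_def, ← twistedSphericalMean_eq_zero_iff _ _ hf]
      refine hmean _ _ ?_
      rw [norm_complexify]
      linarith
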